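/- For $p\in[0,1]$ let $\mu_p$ be the Bernoulli($p$) measure on Cantor space $2^\omega$: the product probability measure under which the coordinates $X(0),X(1),X(2),\dots$ are independent and $\mu_p(\{X: X(n)=1\})=p$ for each $n$. For $e\in\omega$ and $X\in 2^\omega$ let $W_e^X\subseteq\omega$ be the $e$-th set computably enumerable relative to $X$, that is, the domain of the partial function computed by the $e$-th oracle program with oracle $X$. Theorem. Let $p\in[0,1]$, $e\in\omega$ and $A\subseteq\omega$. If $$\mu_p\left(\{X\in 2^\omega : W_e^X=A\}\right)>0,$$ then $A$ is computably enumerable in $p$; that is, for every $P\in 2^\omega$ with $p=\sum_{n} P(n)\,2^{-(n+1)}$, the set $A$ is the domain of a partial function that is recursive in $P$. -/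

import Mathlib

open MeasureTheory

/-- Programs for oracle computations: one constructor for each clause of `Nat.RecursiveIn`. -/
inductive OracleCode : Type
  | zero : OracleCode
  | succ : OracleCode
  | left : OracleCode
  | right : OracleCode
  | oracle : OracleCode
  | pair : OracleCode → OracleCode → OracleCode
  | comp : OracleCode → OracleCode → OracleCode
  | prec : OracleCode → OracleCode → OracleCode
  | rfind : OracleCode → OracleCode

namespace OracleCode

/-- The partial function computed by a program with oracle `g`. The clauses are those of
`Nat.RecursiveIn`: `oracle` queries the oracle, `prec` is primitive recursion and `rfind` is
unbounded search. -/
def eval (g : ℕ →. ℕ) : OracleCode → ℕ →. ℕ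
  | zero => pure 0
  | succ => Nat.succ
  | left => ↑fun n : ℕ => n.unpair.1
  | right => ↑fun n : ℕ => n.unpair.2
  | oracle => g
  | pair cf cg => fun n => Nat.pair <$> eval g cf n <*> eval g cg n
  | comp cf cg => fun n => eval g cg n >>= eval g cf
  | prec cf cg => fun p =>
      let (a, n) := Nat.unpair p
      n.rec (eval g cf a) fun y IH => do
        let i ← IH
        eval g cg (Nat.pair a (Nat.pair y i))
  | rfind cf => fun a => Nat.rfind fun n => (fun m => m = 0) <$> eval g cf (Nat.pair a n)

/-- The index (Gödel number) of a program. -/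
def encodeCode : OracleCode → ℕ
  | zero => 0
  | succ => 1
  | left => 2
  | right => 3
  | oracle => 4
  | pair cf cg => 2 * (2 * Nat.pair (encodeCode cf) (encodeCode cg)) + 5
  | comp cf cg => 2 * (2 * Nat.pair (encodeCode cf) (encodeCode cg) + 1) + 5
  | prec cf cg => (2 * (2 * Nat.pair (encodeCode cf) (encodeCode cg)) + 1) + 5
  | rfind cf => (2 * (2 * encodeCode cf + 1) + 1) + 5

/-- The program with a given index; the inverse of `encodeCode`. -/
def ofNatCode : ℕ → OracleCode
  | 0 => zero
  | 1 => succ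
  | 2 => left
  | 3 => right
  | 4 => oracle
  | n + 5 =>
    let m := n.div2.div2
    have hm : n.div2.div2 < n + 5 := by
      simp only [Nat.div2_val]
      exact
        lt_of_le_of_lt (le_trans (Nat.div_le_self _ _) (Nat.div_le_self _ _))
          (Nat.lt_add_of_pos_right (by norm_num))
    have _m1 : n.div2.div2.unpair.1 < n + 5 := lt_of_le_of_lt (Nat.unpair_left_le _) hm
    have _m2 : n.div2.div2.unpair.2 < n + 5 := lt_of_le_of_lt (Nat.unpair_right_le _) hm
    match n.bodd, n.div2.bodd with
    | false, false => pair (ofNatCode m.unpair.1) (ofNatCode m.unpair.2)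
    | false, true => comp (ofNatCode m.unpair.1) (ofNatCode m.unpair.2)
    | true, false => prec (ofNatCode m.unpair.1) (ofNatCode m.unpair.2)
    | true, true => rfind (ofNatCode m)

/-- Every program has an index. -/
theorem ofNatCode_encodeCode (c : OracleCode) : ofNatCode (encodeCode c) = c := by
  induction c <;> simp [encodeCode, ofNatCode, Nat.div2_val, *]

/-- Programs with oracle `g` compute exactly the functions that are partial recursive in `g`. -/
theorem exists_code {g f : ℕ →. ℕ} : Nat.RecursiveIn {g} f ↔ ∃ c : OracleCode, eval g c = f := by
  refine ⟨fun h => ?_, ?_⟩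
  · induction h with
    | zero => exact ⟨zero, rfl⟩
    | succ => exact ⟨succ, rfl⟩
    | left => exact ⟨left, rfl⟩
    | right => exact ⟨right, rfl⟩
    | oracle g' hg => exact ⟨oracle, (Set.mem_singleton_iff.1 hg).symm⟩
    | pair pf pg hf hg =>
      rcases hf with ⟨cf, rfl⟩; rcases hg with ⟨cg, rfl⟩
      exact ⟨pair cf cg, rfl⟩
    | comp pf pg hf hg =>
      rcases hf with ⟨cf, rfl⟩; rcases hg with ⟨cg, rfl⟩
      exact ⟨comp cf cg, rfl⟩
    | prec pf pg hf hg =>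
      rcases hf with ⟨cf, rfl⟩; rcases hg with ⟨cg, rfl⟩
      exact ⟨prec cf cg, rfl⟩
    | rfind pf hf =>
      rcases hf with ⟨cf, rfl⟩
      exact ⟨rfind cf, rfl⟩
  · rintro ⟨c, rfl⟩
    induction c with
    | zero => exact .zero
    | succ => exact .succ
    | left => exact .left
    | right => exact .right
    | oracle => exact .oracle g rfl
    | pair cf cg pf pg => exact pf.pair pg
    | comp cf cg pf pg => exact pf.comp pg
    | prec cf cg pf pg => exact pf.prec pg
    | rfind cf pf => exact pf.rfind

end OracleCode

/-- The characteristic function of a point of Cantor space `2^ω = (ℕ → Bool)`, as an oracle. -/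
def charOracle (X : ℕ → Bool) : ℕ →. ℕ := fun n => Part.some (X n).toNat

/-- `relCE e X` is the set `W_e^X`: the domain of the partial function computed by the `e`-th
oracle program when the oracle is `X`. -/
def relCE (e : ℕ) (X : ℕ → Bool) : Set ℕ :=
  {n | ((OracleCode.ofNatCode e).eval (charOracle X) n).Dom}

/-- `A` is computably enumerable in `X`: it is the domain of a partial function that is
recursive in `X`. -/
def IsCEIn (A : Set ℕ) (X : ℕ → Bool) : Prop :=
  ∃ f : ℕ →. ℕ, RecursiveIn {charOracle X} f ∧ A = {n | (f n).Dom}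

/-- The sets computably enumerable in `X` are exactly the sets `W_e^X`. -/
theorem isCEIn_iff_exists_relCE {A : Set ℕ} {X : ℕ → Bool} :
    IsCEIn A X ↔ ∃ e, relCE e X = A := by
  constructor
  · rintro ⟨f, hf, rfl⟩
    obtain ⟨c, rfl⟩ := OracleCode.exists_code.1 (RecursiveIn.iff_nat.1 hf)
    exact ⟨c.encodeCode, by simp [relCE, OracleCode.ofNatCode_encodeCode]⟩
  · rintro ⟨e, rfl⟩
    exact ⟨_, RecursiveIn.iff_nat.2 (OracleCode.exists_code.2 ⟨_, rfl⟩), rfl⟩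

/-- The Bernoulli measure `μ_p` on Cantor space: the coordinates are independent, and each of
them is `1` (that is, `true`) with probability `p` and `0` (`false`) with probability `1 - p`. -/
noncomputable def bernoulliCantor (p : unitInterval) : Measure (ℕ → Bool) :=
  Measure.infinitePi fun _ : ℕ => ProbabilityTheory.bernoulliMeasure true false p

/-- `P` is a sequence of binary digits of the real number `x`, that is,
`x = ∑ P(n) 2^{-(n+1)}`. -/
def IsBinaryExpansion (P : ℕ → Bool) (x : ℝ) : Prop :=
  HasSum (fun n : ℕ => ((P n).toNat : ℝ) / 2 ^ (n + 1)) x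

/-! Let `S` be the set of oracles that enumerate exactly `A`, and `U n` the set of those that
enumerate `n`. Since `S` has positive measure, some cylinder `C` approximates it so well that a
majority vote inside `C` decides membership in `A`: `U n ∩ C` contains most of `S` if `n ∈ A`, and
lies in the small set `C \ S` otherwise. A fixed rational `a / b` therefore separates the two cases
(`exists_cylinder_separating`).

It remains to enumerate, using the digits of `p`, all `n` for which `U n ∩ C` has measure above `a /
b`. By the use principle (`mem_relCE_iff`) this set is an increasing union of clopen sets, uniformly
primitive recursive. The measure of a clopen set is a polynomial in `p` and `1 - p` with natural
coefficients, hence continuous and monotone in both. Truncated expansions bound `p` and `1 - p` from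
below and converge to them, so a strict lower bound on the measure is always witnessed by finitely
many digits (`lt_bernoulliCantor_iff`). With denominators cleared, the witness is a primitive
recursive condition on digit sums, and `isCEIn_of_digitSum` applies. -/

namespace OracleCode

/-! ### Computations relative to finite strings and the use principle -/

/-- A finite string as a partial oracle, undefined beyond the length of the string. -/
def stringOracle (σ : List Bool) : ℕ →. ℕ :=
  fun n => ((σ[n]?.map Bool.toNat : Option ℕ) : Part ℕ)

/-- The partial function computed relative to a finite string is partial recursive, uniformly in
the string. -/
theorem partrec_eval_stringOracle (c : OracleCode) :
    Partrec fun x : List Bool × ℕ => eval (stringOracle x.1) c x.2 := by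
  induction c with
  | zero => exact (Computable.const 0).partrec
  | succ => exact (Computable.succ.comp Computable.snd).partrec
  | left => exact (Computable.fst.comp (Computable.unpair.comp Computable.snd)).partrec
  | right => exact (Computable.snd.comp (Computable.unpair.comp Computable.snd)).partrec
  | oracle =>
    have h : Computable fun x : List Bool × ℕ => x.1[x.2]?.map Bool.toNat :=
      (Primrec.option_map (Primrec.list_getElem?.comp Primrec.fst Primrec.snd)
        ((Primrec.dom_bool Bool.toNat).comp Primrec.snd).to₂).to_comp
    exact h.ofOption
  | pair cf cg hf hg =>
    have h1 : Partrec₂ fun (x : List Bool × ℕ) (a : ℕ) =>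
        (eval (stringOracle x.1) cg x.2).map (Nat.pair a) :=
      (hg.comp Computable.fst).map (Primrec₂.natPair.to_comp.comp
        (Computable.snd.comp Computable.fst) Computable.snd).to₂
    refine (hf.bind h1).of_eq fun x => ?_
    simp [eval, Seq.seq]
  | comp cf cg hf hg =>
    exact hg.bind (hf.comp (Computable.pair (Computable.fst.comp Computable.fst)
      Computable.snd)).to₂
  | prec cf cg hf hg =>
    exact Partrec.nat_rec (f := fun x : List Bool × ℕ => x.2.unpair.2)
      (g := fun x => eval (stringOracle x.1) cf x.2.unpair.1)
      (h := fun x yi => eval (stringOracle x.1) cg (Nat.pair x.2.unpair.1 (Nat.pair yi.1 yi.2)))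
      (Computable.snd.comp (Computable.unpair.comp Computable.snd))
      (hf.comp (Computable.pair Computable.fst
        (Computable.fst.comp (Computable.unpair.comp Computable.snd))))
      (hg.comp (Computable.pair (Computable.fst.comp Computable.fst)
        (Primrec₂.natPair.to_comp.comp
          (Computable.fst.comp (Computable.unpair.comp (Computable.snd.comp Computable.fst)))
          (Primrec₂.natPair.to_comp.comp (Computable.fst.comp Computable.snd)
            (Computable.snd.comp Computable.snd))))).to₂
  | rfind cf hf =>
    exact Partrec.rfind (p := fun (x : List Bool × ℕ) n =>
        (eval (stringOracle x.1) cf (Nat.pair x.2 n)).map fun m => decide (m = 0))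
      ((hf.comp (Computable.pair (Computable.fst.comp Computable.fst)
        (Primrec₂.natPair.to_comp.comp (Computable.snd.comp Computable.fst)
          Computable.snd))).map
        ((Primrec.eq.comp Primrec.snd (Primrec.const 0)).decide.to_comp).to₂).to₂

theorem mem_eval_pair {g : ℕ →. ℕ} {cf cg : OracleCode} {n y : ℕ} :
    y ∈ eval g (pair cf cg) n ↔ ∃ a ∈ eval g cf n, ∃ b ∈ eval g cg n, Nat.pair a b = y := by
  simp [eval, Seq.seq]

theorem mem_eval_comp {g : ℕ →. ℕ} {cf cg : OracleCode} {n y : ℕ} :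
    y ∈ eval g (comp cf cg) n ↔ ∃ a ∈ eval g cg n, y ∈ eval g cf a :=
  Part.mem_bind_iff

theorem mem_eval_prec_zero {g : ℕ →. ℕ} {cf cg : OracleCode} {n y : ℕ} :
    y ∈ eval g (prec cf cg) (Nat.pair n 0) ↔ y ∈ eval g cf n := by
  simp [eval]

theorem mem_eval_prec_succ {g : ℕ →. ℕ} {cf cg : OracleCode} {n m y : ℕ} :
    y ∈ eval g (prec cf cg) (Nat.pair n (m + 1)) ↔
      ∃ a ∈ eval g (prec cf cg) (Nat.pair n m), y ∈ eval g cg (Nat.pair n (Nat.pair m a)) := by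
  simp [eval]

theorem mem_eval_rfind {g : ℕ →. ℕ} {cf : OracleCode} {n y : ℕ} :
    y ∈ eval g (rfind cf) n ↔ 0 ∈ eval g cf (Nat.pair n y) ∧
      ∀ m < y, ∃ b ∈ eval g cf (Nat.pair n m), b ≠ 0 := by
  refine Nat.mem_rfind.trans ?_
  simp

/-- Unbounded search respects extension of the oracle because it requires all earlier values to be
defined and nonzero; a larger oracle cannot create an earlier zero. -/
theorem eval_mono {g g' : ℕ →. ℕ} (h : ∀ n, ∀ y ∈ g n, y ∈ g' n) (c : OracleCode) :
    ∀ n, ∀ y ∈ eval g c n, y ∈ eval g' c n := by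
  induction c with
  | zero | succ | left | right => exact fun _ _ hy => hy
  | oracle => exact h
  | pair cf cg hf hg =>
    intro n y hy
    obtain ⟨a, ha, b, hb, rfl⟩ := mem_eval_pair.1 hy
    exact mem_eval_pair.2 ⟨a, hf _ _ ha, b, hg _ _ hb, rfl⟩
  | comp cf cg hf hg =>
    intro n y hy
    obtain ⟨a, ha, hy⟩ := mem_eval_comp.1 hy
    exact mem_eval_comp.2 ⟨a, hg _ _ ha, hf _ _ hy⟩
  | prec cf cg hf hg =>
    intro n
    rw [← Nat.pair_unpair n]
    induction n.unpair.2 with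
    | zero => exact fun y hy => mem_eval_prec_zero.2 (hf _ _ (mem_eval_prec_zero.1 hy))
    | succ k ih =>
      intro y hy
      obtain ⟨a, ha, hy⟩ := mem_eval_prec_succ.1 hy
      exact mem_eval_prec_succ.2 ⟨a, ih _ ha, hg _ _ hy⟩
  | rfind cf hf =>
    intro n y hy
    obtain ⟨h0, hlt⟩ := mem_eval_rfind.1 hy
    refine mem_eval_rfind.2 ⟨hf _ _ h0, fun m hm => ?_⟩
    obtain ⟨b, hb, hb0⟩ := hlt m hm
    exact ⟨b, hf _ _ hb, hb0⟩

/-- A computation relative to the limit of an increasing sequence of oracles uses only one of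
them. -/
theorem exists_mem_eval_of_monotone {g : ℕ →. ℕ} {G : ℕ → ℕ →. ℕ}
    (hmono : ∀ k l, k ≤ l → ∀ n, ∀ y ∈ G k n, y ∈ G l n)
    (hlim : ∀ n, ∀ y ∈ g n, ∃ k, y ∈ G k n) (c : OracleCode) :
    ∀ n, ∀ y ∈ eval g c n, ∃ k, y ∈ eval (G k) c n := by
  have up : ∀ (c : OracleCode) {k l n y}, k ≤ l → y ∈ eval (G k) c n → y ∈ eval (G l) c n :=
    fun c _ _ _ _ hkl hy => eval_mono (hmono _ _ hkl) c _ _ hy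
  induction c with
  | zero | succ | left | right => exact fun _ _ hy => ⟨0, hy⟩
  | oracle => exact hlim
  | pair cf cg hf hg =>
    intro n y hy
    obtain ⟨a, ha, b, hb, rfl⟩ := mem_eval_pair.1 hy
    obtain ⟨k, hk⟩ := hf _ _ ha
    obtain ⟨l, hl⟩ := hg _ _ hb
    exact ⟨max k l, mem_eval_pair.2
      ⟨a, up _ (le_max_left _ _) hk, b, up _ (le_max_right _ _) hl, rfl⟩⟩
  | comp cf cg hf hg =>
    intro n y hy
    obtain ⟨a, ha, hy⟩ := mem_eval_comp.1 hy
    obtain ⟨k, hk⟩ := hg _ _ ha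
    obtain ⟨l, hl⟩ := hf _ _ hy
    exact ⟨max k l, mem_eval_comp.2 ⟨a, up _ (le_max_left _ _) hk, up _ (le_max_right _ _) hl⟩⟩
  | prec cf cg hf hg =>
    intro n
    rw [← Nat.pair_unpair n]
    induction n.unpair.2 with
    | zero => simpa only [mem_eval_prec_zero] using hf n.unpair.1
    | succ m ih =>
      intro y hy
      obtain ⟨a, ha, hy⟩ := mem_eval_prec_succ.1 hy
      obtain ⟨k, hk⟩ := ih _ ha
      obtain ⟨l, hl⟩ := hg _ _ hy
      exact ⟨max k l, mem_eval_prec_succ.2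
        ⟨a, up _ (le_max_left _ _) hk, up _ (le_max_right _ _) hl⟩⟩
  | rfind cf hf =>
    intro n y hy
    obtain ⟨h0, hlt⟩ := mem_eval_rfind.1 hy
    obtain ⟨k, hk⟩ := hf _ _ h0
    -- The search inspects only finitely many earlier values, so one index serves them all.
    have hbelow : ∀ m ≤ y, ∃ l, ∀ i < m, ∃ b ∈ eval (G l) cf (Nat.pair n i), b ≠ 0 := by
      intro m
      induction m with
      | zero => exact fun _ => ⟨0, fun i hi => absurd hi (Nat.not_lt_zero i)⟩
      | succ m ih =>
        intro hm
        obtain ⟨l, hl⟩ := ih (by omega)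
        obtain ⟨b, hb, hb0⟩ := hlt m (by omega)
        obtain ⟨l', hl'⟩ := hf _ _ hb
        refine ⟨max l l', fun i hi => ?_⟩
        rcases Nat.lt_succ_iff_lt_or_eq.1 hi with hi | rfl
        · obtain ⟨b, hb, hb0⟩ := hl i hi
          exact ⟨b, up _ (le_max_left _ _) hb, hb0⟩
        · exact ⟨b, up _ (le_max_right _ _) hl', hb0⟩
    obtain ⟨l, hl⟩ := hbelow y le_rfl
    refine ⟨max k l, mem_eval_rfind.2 ⟨up _ (le_max_left _ _) hk, fun m hm => ?_⟩⟩
    obtain ⟨b, hb, hb0⟩ := hl m hm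
    exact ⟨b, up _ (le_max_right _ _) hb, hb0⟩

end OracleCode

/-- The string formed by the first `k` bits of `X`. -/
def initialSegment (X : ℕ → Bool) (k : ℕ) : List Bool := (List.range k).map X

@[simp] theorem length_initialSegment (X : ℕ → Bool) (k : ℕ) :
    (initialSegment X k).length = k := by simp [initialSegment]

theorem take_initialSegment (X : ℕ → Bool) {j k : ℕ} (h : j ≤ k) :
    (initialSegment X k).take j = initialSegment X j := by
  simp [initialSegment, ← List.map_take, List.take_range, h]

theorem mem_stringOracle_initialSegment {X : ℕ → Bool} {k n y : ℕ} :
    y ∈ OracleCode.stringOracle (initialSegment X k) n ↔ n < k ∧ y = (X n).toNat := by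
  by_cases h : n < k <;>
    simp [OracleCode.stringOracle, initialSegment, h]

/-- The use principle: a number is enumerated relative to `X` if and only if it is enumerated
relative to an initial segment of `X`. -/
theorem mem_relCE_iff {e n : ℕ} {X : ℕ → Bool} :
    n ∈ relCE e X ↔ ∃ k, ((OracleCode.ofNatCode e).eval
      (OracleCode.stringOracle (initialSegment X k)) n).Dom := by
  simp only [relCE, Set.mem_ofPred_eq, Part.dom_iff_mem]
  constructor
  · rintro ⟨y, hy⟩
    obtain ⟨k, hk⟩ := OracleCode.exists_mem_eval_of_monotone
      (G := fun k => OracleCode.stringOracle (initialSegment X k))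
      (fun k l hkl n y hy => by
        rw [mem_stringOracle_initialSegment] at hy ⊢
        exact ⟨by omega, hy.2⟩)
      (fun n y hy => ⟨n + 1, mem_stringOracle_initialSegment.2
        ⟨n.lt_succ_self, by simpa [charOracle] using hy⟩⟩) _ _ _ hy
    exact ⟨k, y, hk⟩
  · rintro ⟨k, y, hy⟩
    exact ⟨y, OracleCode.eval_mono (fun n y hy => by
      simpa [charOracle] using (mem_stringOracle_initialSegment.1 hy).2) _ _ _ hy⟩

/-! ### Stages of enumeration and searches over digit sums -/

/-- The domain of a partial recursive function is the union of an increasing sequence of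
uniformly primitive recursive sets. -/
theorem Partrec.exists_stages {α β : Type*} [Primcodable α] [Primcodable β] {f : α →. β}
    (hf : Partrec f) :
    ∃ R : ℕ → α → Prop, PrimrecRel R ∧ (∀ s t a, s ≤ t → R s a → R t a) ∧
      ∀ a, (f a).Dom ↔ ∃ t, R t a := by
  obtain ⟨c, hc⟩ := Nat.Partrec.Code.exists_code.1 hf
  refine ⟨fun t a => (Nat.Partrec.Code.evaln t c (Encodable.encode a)).isSome = true, ?_, ?_, ?_⟩
  · exact Primrec.eq.comp (Primrec.option_isSome.comp (Nat.Partrec.Code.primrec_evaln.comp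
      ((Primrec.fst.pair (Primrec.const c)).pair (Primrec.encode.comp Primrec.snd))))
      (Primrec.const true)
  · intro s t a hst h
    obtain ⟨x, hx⟩ := Option.isSome_iff_exists.1 h
    exact Option.isSome_iff_exists.2 ⟨x, Nat.Partrec.Code.evaln_mono hst hx⟩
  · intro a
    have h : (f a).Dom ↔ ∃ x, x ∈ c.eval (Encodable.encode a) := by
      rw [hc, ← Part.dom_iff_mem]
      simp
    simp only [h, Nat.Partrec.Code.evaln_complete, Option.isSome_iff_exists, Option.mem_def]
    exact exists_comm

/-- The binary digits of `X` below place `m`, read as a natural number. -/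
def digitSum (X : ℕ → Bool) : ℕ → ℕ
  | 0 => 0
  | m + 1 => 2 * digitSum X m + (X m).toNat

theorem Nat.RecursiveIn.comp_total {O : Set (ℕ →. ℕ)} {f g : ℕ → ℕ}
    (hf : Nat.RecursiveIn O fun n => Part.some (f n))
    (hg : Nat.RecursiveIn O fun n => Part.some (g n)) :
    Nat.RecursiveIn O fun n => Part.some (f (g n)) :=
  (hf.comp hg).of_eq fun n => Part.bind_some (g n) _

theorem Nat.RecursiveIn.pair_total {O : Set (ℕ →. ℕ)} {f g : ℕ → ℕ}
    (hf : Nat.RecursiveIn O fun n => Part.some (f n))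
    (hg : Nat.RecursiveIn O fun n => Part.some (g n)) :
    Nat.RecursiveIn O fun n => Part.some (Nat.pair (f n) (g n)) :=
  (hf.pair hg).of_eq fun n => by simp [Seq.seq]

theorem Primrec.recursiveIn_total {O : Set (ℕ →. ℕ)} {f : ℕ → ℕ} (hf : Primrec f) :
    Nat.RecursiveIn O fun n => Part.some (f n) :=
  (Primrec.nat_iff.1 hf).recursiveIn

theorem recursiveIn_digitSum (X : ℕ → Bool) :
    Nat.RecursiveIn {charOracle X} fun m => Part.some (digitSum X m) := by
  have h1 : Primrec fun v : ℕ => v.unpair.2.unpair.1 :=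
    Primrec.fst.comp (Primrec.unpair.comp (Primrec.snd.comp Primrec.unpair))
  have h2 : Primrec fun v : ℕ => v.unpair.2.unpair.2 :=
    Primrec.snd.comp (Primrec.unpair.comp (Primrec.snd.comp Primrec.unpair))
  have h3 : Primrec fun v : ℕ => 2 * v.unpair.1 + v.unpair.2 :=
    Primrec.nat_add.comp (Primrec.nat_mul.comp (Primrec.const 2)
      (Primrec.fst.comp Primrec.unpair)) (Primrec.snd.comp Primrec.unpair)
  -- The recursion needs no parameter; `0` is a dummy.
  have hpair : Primrec fun m => Nat.pair 0 m :=
    Primrec₂.natPair.comp (Primrec.const 0) Primrec.id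
  have horacle : Nat.RecursiveIn {charOracle X} fun n => Part.some (X n).toNat :=
    .oracle (charOracle X) rfl
  have hstep := h3.recursiveIn_total.comp_total
    (h2.recursiveIn_total.pair_total (horacle.comp_total h1.recursiveIn_total))
  refine ((Nat.RecursiveIn.zero.prec hstep).comp hpair.recursiveIn_total).of_eq fun m => ?_
  refine (Part.bind_some _ _).trans ?_
  simp only [Nat.unpair_pair]
  induction m with
  | zero => rfl
  | succ m ih =>
    refine (congrArg (Part.bind · _) ih).trans ?_
    simp [digitSum]

/-- A set defined by an unbounded search over a primitive recursive relation that consults `X` only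
through its digit sums is computably enumerable in `X`. -/
theorem isCEIn_of_digitSum (X : ℕ → Bool) {R : ℕ × ℕ × ℕ × ℕ → Prop} (hR : PrimrecPred R) :
    IsCEIn {n | ∃ t m, R (n, t, m, digitSum X m)} X := by
  classical
  have hl : Primrec fun v : ℕ => v.unpair.1 := Primrec.fst.comp Primrec.unpair
  have hr : Primrec fun v : ℕ => v.unpair.2 := Primrec.snd.comp Primrec.unpair
  -- The argument codes `((n, (t, m)), d)`, where `d` will be the digit sum at `m`; the value `0`
  -- stops the search.
  have h1 : Primrec fun v : ℕ => (if R (v.unpair.1.unpair.1, v.unpair.1.unpair.2.unpair.1,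
      v.unpair.1.unpair.2.unpair.2, v.unpair.2) then 0 else 1 : ℕ) :=
    Primrec.ite (hR.comp ((hl.comp hl).pair ((hl.comp (hr.comp hl)).pair
      ((hr.comp (hr.comp hl)).pair hr)))) (Primrec.const 0) (Primrec.const 1)
  have h2 := (h1.recursiveIn_total.comp_total (Primrec.id.recursiveIn_total.pair_total
    ((recursiveIn_digitSum X).comp_total (hr.comp hr).recursiveIn_total))).rfind
  refine ⟨_, RecursiveIn.iff_nat.2 h2, ?_⟩
  ext n
  refine Iff.trans ?_ Nat.rfind_dom.symm
  constructor
  · rintro ⟨t, m, h⟩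
    exact ⟨Nat.pair t m, by simp [h], fun _ => by trivial⟩
  · rintro ⟨k, h, -⟩
    refine ⟨k.unpair.1, k.unpair.2, ?_⟩
    by_contra hn
    simp [hn] at h
-- Weighted counts of strings
/-- The list of all strings of length `s`. -/
def words : ℕ → List (List Bool)
  | 0 => [[]]
  | s + 1 => (words s).flatMap fun σ => [false :: σ, true :: σ]

theorem mem_words {s : ℕ} {σ : List Bool} : σ ∈ words s ↔ σ.length = s := by
  induction s generalizing σ with
  | zero => simp [words]
  | succ s ih =>
    rcases σ with - | ⟨x, σ⟩
    · simp [words]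
    · cases x <;> simp [words, ih]

theorem nodup_words (s : ℕ) : (words s).Nodup := by
  induction s with
  | zero => simp [words]
  | succ s ih =>
    refine List.nodup_flatMap.2 ⟨fun σ _ => by simp, ih.imp fun {σ τ} hne => ?_⟩
    simp [Function.onFun, List.disjoint_left, hne]

theorem primrec_words : Primrec words := by
  refine (Primrec.nat_rec₁ [[]] (f := fun _ (l : List (List Bool)) =>
    l.flatMap fun σ => [false :: σ, true :: σ]) ?_).of_eq fun s => ?_
  · refine Primrec.list_flatMap Primrec.snd ?_
    refine Primrec.list_cons.comp (Primrec.list_cons.comp (Primrec.const false) Primrec.snd)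
      (Primrec.list_cons.comp (Primrec.list_cons.comp (Primrec.const true) Primrec.snd)
        (Primrec.const []))
  · induction s with
    | zero => rfl
    | succ s ih => simp only [words, ← ih]

/-- The weight of a string when each `1` has weight `a` and each `0` has weight `b`. -/
def weight {M : Type*} [Monoid M] (a b : M) (σ : List Bool) : M :=
  (σ.map fun x => if x then a else b).prod

open Classical in
/-- The total weight of the strings of length `s` that satisfy `P`. -/
noncomputable def mass {M : Type*} [Semiring M] (P : List Bool → Prop) (s : ℕ) (a b : M) : M :=
  ((words s).map fun σ => if P σ then weight a b σ else 0).sum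

theorem primrec_weight : Primrec fun v : ℕ × ℕ × List Bool => weight v.1 v.2.1 v.2.2 := by
  have h : Primrec₂ fun (v : ℕ × ℕ × List Bool) (x : Bool × ℕ) =>
      (if x.1 then v.1 else v.2.1) * x.2 :=
    (Primrec.nat_mul.comp
      (Primrec.ite (Primrec.eq.comp (Primrec.fst.comp Primrec.snd) (Primrec.const true))
        (Primrec.fst.comp Primrec.fst) (Primrec.fst.comp (Primrec.snd.comp Primrec.fst)))
      (Primrec.snd.comp Primrec.snd)).to₂
  refine (Primrec.list_foldr (Primrec.snd.comp Primrec.snd) (Primrec.const 1) h).of_eq fun v => ?_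
  simp [weight, List.prod_eq_foldr, List.foldr_map]

theorem primrec_mass {α : Type*} [Primcodable α] {P : α → List Bool → Prop} (hP : PrimrecRel P)
    {s a b : α → ℕ} (hs : Primrec s) (ha : Primrec a) (hb : Primrec b) :
    Primrec fun v => mass (P v) (s v) (a v) (b v) := by
  classical
  have h : Primrec₂ fun (v : α) (x : List Bool × ℕ) =>
      (if P v x.1 then weight (a v) (b v) x.1 else 0) + x.2 :=
    (Primrec.nat_add.comp
      (Primrec.ite (hP.comp Primrec.fst (Primrec.fst.comp Primrec.snd))
        (primrec_weight.comp ((ha.comp Primrec.fst).pair ((hb.comp Primrec.fst).pair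
          (Primrec.fst.comp Primrec.snd)))) (Primrec.const 0))
      (Primrec.snd.comp Primrec.snd)).to₂
  refine (Primrec.list_foldr (primrec_words.comp hs) (Primrec.const 0) h).of_eq fun v => ?_
  simp only [mass, List.sum_eq_foldr, List.foldr_map]

theorem weight_mul {M : Type*} [CommMonoid M] (a b c : M) (σ : List Bool) :
    weight (a * c) (b * c) σ = weight a b σ * c ^ σ.length := by
  induction σ with
  | nil => simp [weight]
  | cons x σ ih =>
    simp only [weight, List.map_cons, List.prod_cons, List.length_cons] at ih ⊢
    rw [ih, pow_succ']
    split_ifs <;> exact mul_mul_mul_comm _ _ _ _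

/-- All strings counted have length `s`, so the mass is homogeneous of degree `s`. This is what
clears the denominators `2 ^ m`. -/
theorem mass_mul {M : Type*} [CommSemiring M] (P : List Bool → Prop) (s : ℕ) (a b c : M) :
    mass P s (a * c) (b * c) = mass P s a b * c ^ s := by
  simp only [mass, ← List.sum_map_mul_right, ite_mul, zero_mul, weight_mul]
  refine congrArg List.sum (List.map_congr_left fun σ hσ => ?_)
  rw [mem_words.1 hσ]

theorem natCast_mass (P : List Bool → Prop) (s a b : ℕ) :
    ((mass P s a b : ℕ) : ℝ) = mass P s (a : ℝ) (b : ℝ) := by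
  simp [mass, weight, Nat.cast_list_sum, Nat.cast_list_prod, Function.comp_def, apply_ite]

theorem weight_nonneg {a b : ℝ} (ha : 0 ≤ a) (hb : 0 ≤ b) (σ : List Bool) : 0 ≤ weight a b σ :=
  List.prod_nonneg fun x hx => by
    obtain ⟨y, -, rfl⟩ := List.mem_map.1 hx
    split_ifs <;> assumption

theorem weight_le_weight {a b a' b' : ℝ} (ha : 0 ≤ a) (hb : 0 ≤ b) (haa : a ≤ a') (hbb : b ≤ b')
    (σ : List Bool) : weight a b σ ≤ weight a' b' σ := by
  induction σ with
  | nil => simp [weight]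
  | cons x σ ih =>
    have h0 := weight_nonneg ha hb σ
    simp only [weight, List.map_cons, List.prod_cons] at ih h0 ⊢
    split_ifs
    · exact mul_le_mul haa ih h0 (ha.trans haa)
    · exact mul_le_mul hbb ih h0 (hb.trans hbb)

theorem mass_le_mass (P : List Bool → Prop) (s : ℕ) {a b a' b' : ℝ} (ha : 0 ≤ a) (hb : 0 ≤ b)
    (haa : a ≤ a') (hbb : b ≤ b') : mass P s a b ≤ mass P s a' b' :=
  List.sum_le_sum fun σ _ => by
    split_ifs
    · exact weight_le_weight ha hb haa hbb σ
    · exact le_rfl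

theorem continuous_mass (P : List Bool → Prop) (s : ℕ) :
    Continuous fun x : ℝ × ℝ => mass P s x.1 x.2 := by
  refine continuous_list_sum _ fun σ _ => ?_
  split_ifs
  · refine continuous_list_prod _ fun x _ => ?_
    split_ifs <;> fun_prop
  · fun_prop

/-! ### Bernoulli measure of clopen sets -/

theorem initialSegment_eq_iff {X Y : ℕ → Bool} {s : ℕ} :
    initialSegment X s = initialSegment Y s ↔ ∀ i < s, X i = Y i := by
  simp [initialSegment, List.map_inj_left]

theorem exists_initialSegment_eq (σ : List Bool) : ∃ X, initialSegment X σ.length = σ :=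
  ⟨fun i => σ.getD i false, List.ext_getElem (by simp) fun i _ h => by
    simp [initialSegment, h]⟩

theorem weight_initialSegment {M : Type*} [CommMonoid M] (a b : M) (X : ℕ → Bool) (s : ℕ) :
    weight a b (initialSegment X s) = ∏ i ∈ Finset.range s, if X i then a else b := by
  induction s with
  | zero => simp [weight, initialSegment]
  | succ s ih =>
    rw [Finset.prod_range_succ, ← ih]
    simp [weight, initialSegment, List.range_succ]

theorem setOf_initialSegment_eq (X : ℕ → Bool) (s : ℕ) :
    {Y | initialSegment Y s = initialSegment X s} =
      Set.pi (Finset.range s : Set ℕ) fun i => {X i} := by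
  ext Y
  simp [initialSegment_eq_iff]

theorem setOf_initialSegment_eq_biUnion (P : List Bool → Prop) [DecidablePred P] (s : ℕ) :
    {X | P (initialSegment X s)} =
      ⋃ σ ∈ (words s).toFinset.filter P, {X | initialSegment X s = σ} := by
  ext X
  simp [mem_words]

theorem measurableSet_initialSegment_eq (s : ℕ) (σ : List Bool) :
    MeasurableSet {X : ℕ → Bool | initialSegment X s = σ} := by
  by_cases h : ∃ X, initialSegment X s = σ
  · obtain ⟨X, rfl⟩ := h
    rw [setOf_initialSegment_eq]
    exact MeasurableSet.pi (Finset.countable_toSet _) fun _ _ => measurableSet_singleton _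
  · convert MeasurableSet.empty
    exact Set.eq_empty_of_forall_notMem fun X hX => h ⟨X, hX⟩

theorem measurableSet_initialSegment (P : List Bool → Prop) (s : ℕ) :
    MeasurableSet {X : ℕ → Bool | P (initialSegment X s)} := by
  classical
  rw [setOf_initialSegment_eq_biUnion]
  exact Finset.measurableSet_biUnion _ fun σ _ => measurableSet_initialSegment_eq s σ

instance (p : unitInterval) : IsProbabilityMeasure (bernoulliCantor p) := by
  unfold bernoulliCantor
  infer_instance

theorem bernoulliCantor_initialSegment_eq (p : unitInterval) (X : ℕ → Bool) (s : ℕ) :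
    (bernoulliCantor p).real {Y | initialSegment Y s = initialSegment X s} =
      weight (p : ℝ) (1 - p) (initialSegment X s) := by
  rw [setOf_initialSegment_eq, bernoulliCantor, measureReal_def,
    Measure.infinitePi_pi _ fun _ _ => measurableSet_singleton _, ENNReal.toReal_prod,
    weight_initialSegment]
  refine Finset.prod_congr rfl fun i _ => ?_
  rw [← measureReal_def, ProbabilityTheory.bernoulliMeasure_real_apply _ (measurableSet_singleton _)]
  cases X i <;> simp

/-- The Bernoulli measure of a set determined by the first `s` bits. -/
theorem bernoulliCantor_initialSegment (p : unitInterval) (P : List Bool → Prop) (s : ℕ) :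
    (bernoulliCantor p).real {X | P (initialSegment X s)} = mass P s (p : ℝ) (1 - p) := by
  classical
  rw [setOf_initialSegment_eq_biUnion, measureReal_biUnion_finset]
  · rw [mass, ← List.sum_toFinset _ (nodup_words s), Finset.sum_filter]
    refine Finset.sum_congr rfl fun σ hσ => ?_
    have hσ : σ.length = s := by simpa [mem_words] using hσ
    obtain ⟨X, hX⟩ := exists_initialSegment_eq σ
    subst hσ
    have h := bernoulliCantor_initialSegment_eq p X σ.length
    rw [hX] at h
    rw [h]
  · intro σ _ τ _ hne
    exact Set.disjoint_left.2 fun X hσ hτ => hne (hσ.symm.trans hτ)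
  · exact fun σ _ => measurableSet_initialSegment_eq s σ

/-! ### Lower approximations from binary digits -/

theorem digitSum_add_digitSum_not (X : ℕ → Bool) (m : ℕ) :
    digitSum X m + digitSum (fun i => !X i) m + 1 = 2 ^ m := by
  induction m with
  | zero => rfl
  | succ m ih =>
    rw [pow_succ, ← ih]
    simp only [digitSum]
    cases X m <;> simp <;> ring

theorem digitSum_div (X : ℕ → Bool) (m : ℕ) :
    (digitSum X m : ℝ) / 2 ^ m = ∑ i ∈ Finset.range m, ((X i).toNat : ℝ) / 2 ^ (i + 1) := by
  induction m with
  | zero => simp [digitSum]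
  | succ m ih =>
    rw [Finset.sum_range_succ, ← ih, digitSum]
    push_cast
    field_simp
    ring

namespace IsBinaryExpansion

variable {X : ℕ → Bool} {x : ℝ}

/-- Subtract termwise from the geometric series with sum `1`. Uniqueness of expansions plays no
role, so dyadic `x` needs no special care. -/
theorem not (h : IsBinaryExpansion X x) : IsBinaryExpansion (fun i => !X i) (1 - x) := by
  have h1 : HasSum (fun n : ℕ => (1 : ℝ) / 2 / 2 ^ n) 1 := hasSum_geometric_two' 1
  have h2 := h1.sub h
  have h3 (n : ℕ) : (1 : ℝ) / 2 / 2 ^ n - ((X n).toNat : ℝ) / 2 ^ (n + 1) =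
      ((!X n).toNat : ℝ) / 2 ^ (n + 1) := by
    cases X n <;> simp [pow_succ', div_eq_mul_inv, mul_comm]
  simp only [h3] at h2
  exact h2

theorem digitSum_le (h : IsBinaryExpansion X x) (m : ℕ) : (digitSum X m : ℝ) / 2 ^ m ≤ x := by
  rw [digitSum_div]
  exact sum_le_hasSum _ (fun i _ => by positivity) h

theorem tendsto_digitSum (h : IsBinaryExpansion X x) :
    Filter.Tendsto (fun m => (digitSum X m : ℝ) / 2 ^ m) Filter.atTop (nhds x) := by
  simpa only [digitSum_div] using HasSum.tendsto_sum_nat h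

end IsBinaryExpansion
theorem mass_digitSum (X : ℕ → Bool) (P : List Bool → Prop) (s m : ℕ) :
    (mass P s (digitSum X m) (digitSum (fun i => !X i) m) : ℕ) =
      mass P s ((digitSum X m : ℝ) / 2 ^ m) ((digitSum (fun i => !X i) m : ℝ) / 2 ^ m) *
        2 ^ (m * s) := by
  rw [natCast_mass, pow_mul, ← mass_mul]
  congr <;> field_simp

/-- The measure of a set determined by finitely many bits exceeds `a / b` if and only if this can be
seen from a lower approximation based on finitely many digits of `p`. -/
theorem lt_bernoulliCantor_iff {p : unitInterval} {X : ℕ → Bool}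
    (hX : IsBinaryExpansion X (p : ℝ)) (P : List Bool → Prop) (s : ℕ) {a b : ℕ} (hb : 0 < b) :
    (a : ℝ) / b < (bernoulliCantor p).real {Y | P (initialSegment Y s)} ↔
      ∃ m, a * 2 ^ (m * s) < mass P s (digitSum X m) (2 ^ m - 1 - digitSum X m) * b := by
  -- Complementary digits sum to `2 ^ m - 1`, so the truncated subtraction is exact, and the digits
  -- of `1 - p` require no further oracle.
  have hsub (m : ℕ) : 2 ^ m - 1 - digitSum X m = digitSum (fun i => !X i) m := by
    have := digitSum_add_digitSum_not X m
    omega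
  have key (m : ℕ) : a * 2 ^ (m * s) < mass P s (digitSum X m) (2 ^ m - 1 - digitSum X m) * b ↔
      (a : ℝ) / b <
        mass P s ((digitSum X m : ℝ) / 2 ^ m) ((digitSum (fun i => !X i) m : ℝ) / 2 ^ m) := by
    rw [hsub, ← Nat.cast_lt (α := ℝ), Nat.cast_mul, Nat.cast_mul, mass_digitSum,
      div_lt_iff₀ (by positivity), mul_right_comm]
    push_cast
    exact mul_lt_mul_iff_left₀ (by positivity)
  simp only [key, bernoulliCantor_initialSegment]
  constructor
  · intro h
    -- A strict inequality at the limit already holds at a finite stage; the converse direction is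
    -- monotonicity in both weights.
    have hlim := ((continuous_mass P s).tendsto ((p : ℝ), 1 - (p : ℝ))).comp
      (hX.tendsto_digitSum.prodMk_nhds hX.not.tendsto_digitSum)
    exact (hlim.eventually_const_lt h).exists
  · rintro ⟨m, hm⟩
    exact hm.trans_le (mass_le_mass P s (by positivity) (by positivity) (hX.digitSum_le m)
      (hX.not.digitSum_le m))

/-! ### Majority vote inside a cylinder -/

/-- A cylinder is determined by finitely many bits. -/
theorem exists_words_of_mem_measurableCylinders {C : Set (ℕ → Bool)}
    (hC : C ∈ measurableCylinders fun _ : ℕ => Bool) :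
    ∃ (k : ℕ) (G : List (List Bool)), ∀ X, X ∈ C ↔ initialSegment X k ∈ G := by
  classical
  obtain ⟨s, S, -, rfl⟩ := (mem_measurableCylinders C).1 hC
  obtain ⟨k, hk⟩ : ∃ k, ∀ i ∈ s, i < k :=
    ⟨s.sup id + 1, fun i hi => Nat.lt_succ_of_le (Finset.le_sup (f := id) hi)⟩
  refine ⟨k, (words k).filter fun σ => ∃ X ∈ cylinder s S, initialSegment X k = σ, fun X => ?_⟩
  simp only [List.mem_filter, mem_words, length_initialSegment, decide_eq_true_eq, true_and]
  refine ⟨fun h => ⟨X, h, rfl⟩, fun ⟨Y, hY, h⟩ => ?_⟩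
  rw [mem_cylinder] at hY ⊢
  convert hY using 1
  ext i
  exact (initialSegment_eq_iff.1 h i (hk i i.2)).symm

theorem exists_nat_div_btwn {x y : ℝ} (hx : 0 ≤ x) (hxy : x < y) :
    ∃ a b : ℕ, 0 < b ∧ x < (a : ℝ) / b ∧ (a : ℝ) / b < y := by
  obtain ⟨q, hxq, hqy⟩ := exists_rat_btwn hxy
  have hq : 0 ≤ q := by exact_mod_cast (hx.trans_lt hxq).le
  refine ⟨q.num.toNat, q.den, q.den_pos, ?_⟩
  have h : ((q.num.toNat : ℕ) : ℝ) / q.den = q := by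
    rw [Rat.cast_def]
    congr 1
    exact_mod_cast congrArg (Int.cast (R := ℝ)) (Int.toNat_of_nonneg (Rat.num_nonneg.2 hq))
  rw [h]
  exact ⟨hxq, hqy⟩

/-- If the events `U n` agree with membership in `A` simultaneously with positive probability, then
inside some cylinder the probability of `U n` separates `n ∈ A` from `n ∉ A`. -/
theorem exists_cylinder_separating (p : unitInterval) {U : ℕ → Set (ℕ → Bool)}
    (hU : ∀ n, MeasurableSet (U n)) {A : Set ℕ}
    (h : 0 < bernoulliCantor p {X | ∀ n, X ∈ U n ↔ n ∈ A}) :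
    ∃ C ∈ measurableCylinders fun _ : ℕ => Bool, ∃ a b : ℕ, 0 < b ∧
      ∀ n, n ∈ A ↔ (a : ℝ) / b < (bernoulliCantor p).real (U n ∩ C) := by
  set S : Set (ℕ → Bool) := {X | ∀ n, X ∈ U n ↔ n ∈ A} with hS_def
  have hS : MeasurableSet S := by
    have : S = ⋂ n, {X | X ∈ U n ↔ n ∈ A} := by
      ext X
      simp [S]
    rw [this]
    exact MeasurableSet.iInter fun n => (hU n).iff (MeasurableSet.const _)
  have hpos : 0 < (bernoulliCantor p).real S := ENNReal.toReal_pos h.ne' (measure_ne_top _ _)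
  -- Cylinders form an algebra generating the σ-algebra, hence are dense in measure.
  obtain ⟨C, hC, hSC⟩ := (Measure.MeasureDense.of_generateFrom_isSetAlgebra_finite
    (μ := bernoulliCantor p) isSetAlgebra_measurableCylinders
    generateFrom_measurableCylinders.symm).approx S hS (measure_ne_top _ _)
    ((bernoulliCantor p).real S / 4) (by positivity)
  have hSC : (bernoulliCantor p).real (symmDiff S C) < (bernoulliCantor p).real S / 4 :=
    (ENNReal.lt_ofReal_iff_toReal_lt (measure_ne_top _ _)).1 hSC
  -- `U n ∩ C` has measure above three quarters of that of `S` if `n ∈ A`, and below one quarter if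
  -- not; any threshold between would do.
  obtain ⟨a, b, hb, hlo, hhi⟩ := exists_nat_div_btwn
    (x := (bernoulliCantor p).real S / 4) (y := (bernoulliCantor p).real S / 2)
    (by positivity) (by linarith)
  refine ⟨C, hC, a, b, hb, fun n => ⟨fun hn => ?_, fun hn => ?_⟩⟩
  · have hsub : S ⊆ (U n ∩ C) ∪ symmDiff S C := fun X hX => by
      by_cases hXC : X ∈ C
      · exact Or.inl ⟨(hX n).2 hn, hXC⟩
      · exact Or.inr (Or.inl ⟨hX, hXC⟩)
    have h1 := (measureReal_mono hsub).trans
      (measureReal_union_le (μ := bernoulliCantor p) (U n ∩ C) (symmDiff S C))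
    linarith
  · by_contra hnA
    have hsub : U n ∩ C ⊆ symmDiff S C := fun X hX =>
      Or.inr ⟨hX.2, fun hXS => hnA ((hXS n).1 hX.1)⟩
    have h1 := measureReal_mono (μ := bernoulliCantor p) hsub
    linarith

/-! ### Assembling the enumeration -/

theorem primrecRel_mem_take {α : Type*} [Primcodable α] (G : List (List Bool)) (k : ℕ) :
    PrimrecRel fun (_ : α) (σ : List Bool) => σ.take k ∈ G := by
  have h : PrimrecRel fun (σ τ : List Bool) => σ = τ := Primrec.eq
  refine (h.exists_mem_list.comp (Primrec.const G)
    (Primrec.list_take.comp (Primrec.const k) Primrec.snd)).of_eq fun v => ?_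
  simp

theorem primrec_pow {c : ℕ} : Primrec fun n : ℕ => c ^ n := by
  refine (Primrec.nat_rec₁ 1 (f := fun _ y => y * c)
    (Primrec.nat_mul.comp Primrec.snd (Primrec.const c))).of_eq fun n => ?_
  induction n with
  | zero => rfl
  | succ n ih => simp only [pow_succ, ← ih]

theorem mainTheorem6 (p : unitInterval) (P : ℕ → Bool) (hP : IsBinaryExpansion P (p : ℝ))
    (e : ℕ) (A : Set ℕ) (h : 0 < bernoulliCantor p {X : ℕ → Bool | relCE e X = A}) :
    IsCEIn A P := by
  obtain ⟨R, hR, hRmono, hRdom⟩ :=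
    (OracleCode.partrec_eval_stringOracle (OracleCode.ofNatCode e)).exists_stages
  -- `R` is monotone in time but need not be in the string, so all prefixes of length at most `t`
  -- are tried; this makes the stages increasing.
  let stage (n t : ℕ) (σ : List Bool) : Prop := ∃ j < t + 1, R t (σ.take j, n)
  have stage_mono {n s t s' t' : ℕ} {X : ℕ → Bool} (hst : s ≤ t) (hs : s ≤ s') (ht : t ≤ t')
      (hX : stage n s (initialSegment X s')) : stage n t (initialSegment X t') := by
    obtain ⟨j, hj, hX⟩ := hX
    rw [take_initialSegment X (by omega)] at hX
    refine ⟨j, by omega, ?_⟩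
    rw [take_initialSegment X (by omega)]
    exact hRmono _ _ _ hst hX
  -- At stage `t` strings have length `t + k`: long enough for the prefixes tried and, later, for
  -- the `k` bits that decide `C`.
  have mem_iff (k n : ℕ) (X : ℕ → Bool) :
      n ∈ relCE e X ↔ ∃ t, stage n t (initialSegment X (t + k)) := by
    simp only [mem_relCE_iff, hRdom (_, n)]
    constructor
    · rintro ⟨j, t, hX⟩
      refine ⟨max j t, j, by omega, ?_⟩
      rw [take_initialSegment X (by omega)]
      exact hRmono _ _ _ (le_max_right _ _) hX
    · rintro ⟨t, j, hj, hX⟩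
      rw [take_initialSegment X (by omega)] at hX
      exact ⟨j, t, hX⟩
  have hmeas (n : ℕ) : MeasurableSet {X | n ∈ relCE e X} := by
    simp only [mem_iff 0, Set.ofPred_exists]
    exact MeasurableSet.iUnion fun t => measurableSet_initialSegment _ _
  have hS : {X : ℕ → Bool | relCE e X = A} = {X | ∀ n, X ∈ {X | n ∈ relCE e X} ↔ n ∈ A} := by
    ext X
    exact Set.ext_iff
  rw [hS] at h
  obtain ⟨C, hC, a, b, hb, hA⟩ := exists_cylinder_separating p hmeas h
  obtain ⟨k, G, hG⟩ := exists_words_of_mem_measurableCylinders hC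
  let E (n t : ℕ) (σ : List Bool) : Prop := stage n t σ ∧ σ.take k ∈ G
  have hunion (n : ℕ) : {X | n ∈ relCE e X} ∩ C = ⋃ t, {X | E n t (initialSegment X (t + k))} := by
    ext X
    simp only [Set.mem_inter_iff, Set.mem_ofPred_eq, Set.mem_iUnion, E, mem_iff k, hG,
      take_initialSegment X (Nat.le_add_left k _), exists_and_right]
  have hmono (n : ℕ) : Monotone fun t => {X | E n t (initialSegment X (t + k))} := by
    rintro s t hst X ⟨h1, h2⟩
    rw [take_initialSegment X (Nat.le_add_left k _)] at h2
    refine ⟨stage_mono hst (by omega) (by omega) h1, ?_⟩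
    rwa [take_initialSegment X (Nat.le_add_left k _)]
  have hlt (n : ℕ) : (a : ℝ) / b < (bernoulliCantor p).real ({X | n ∈ relCE e X} ∩ C) ↔
      ∃ t, (a : ℝ) / b < (bernoulliCantor p).real {X | E n t (initialSegment X (t + k))} := by
    rw [hunion]
    constructor
    · intro h
      -- Continuity of the measure from below along the increasing stages.
      have hlim := (ENNReal.tendsto_toReal (measure_ne_top (bernoulliCantor p) _)).comp
        (tendsto_measure_iUnion_atTop (hmono n))
      exact (hlim.eventually_const_lt h).exists
    · rintro ⟨t, ht⟩
      exact ht.trans_le (measureReal_mono (Set.subset_iUnion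
        (fun t => {X | E n t (initialSegment X (t + k))}) t))
  have hE : PrimrecRel fun (v : ℕ × ℕ × ℕ × ℕ) (σ : List Bool) => E v.1 v.2.1 σ := by
    have hR' : PrimrecRel fun (j : ℕ) (w : (ℕ × ℕ × ℕ × ℕ) × List Bool) =>
        R w.1.2.1 (w.2.take j, w.1.1) :=
      hR.comp (Primrec.fst.comp (Primrec.snd.comp (Primrec.fst.comp Primrec.snd)))
        ((Primrec.list_take.comp Primrec.fst (Primrec.snd.comp Primrec.snd)).pair
          (Primrec.fst.comp (Primrec.fst.comp Primrec.snd)))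
    have h1 : PrimrecRel fun (v : ℕ × ℕ × ℕ × ℕ) (σ : List Bool) => stage v.1 v.2.1 σ :=
      (hR'.exists_mem_list.comp (Primrec.list_range.comp (Primrec.succ.comp
        (Primrec.fst.comp (Primrec.snd.comp Primrec.fst)))) Primrec.id).of_eq fun v => by
          simp [stage]
    exact PrimrecPred.and h1 (primrecRel_mem_take G k)
  have ht : Primrec fun v : ℕ × ℕ × ℕ × ℕ => v.2.1 + k :=
    Primrec.nat_add.comp (Primrec.fst.comp Primrec.snd) (Primrec.const k)
  have hm : Primrec fun v : ℕ × ℕ × ℕ × ℕ => v.2.2.1 :=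
    Primrec.fst.comp (Primrec.snd.comp Primrec.snd)
  have hd : Primrec fun v : ℕ × ℕ × ℕ × ℕ => v.2.2.2 :=
    Primrec.snd.comp (Primrec.snd.comp Primrec.snd)
  have hQ : PrimrecPred fun v : ℕ × ℕ × ℕ × ℕ => a * 2 ^ (v.2.2.1 * (v.2.1 + k)) <
      mass (E v.1 v.2.1) (v.2.1 + k) v.2.2.2 (2 ^ v.2.2.1 - 1 - v.2.2.2) * b :=
    Primrec.nat_lt.comp
      (Primrec.nat_mul.comp (Primrec.const a) (primrec_pow.comp (Primrec.nat_mul.comp hm ht)))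
      (Primrec.nat_mul.comp (primrec_mass hE ht hd (Primrec.nat_sub.comp
        (Primrec.nat_sub.comp (primrec_pow.comp hm) (Primrec.const 1)) hd)) (Primrec.const b))
  convert isCEIn_of_digitSum P hQ using 1
  ext n
  simp only [hA, hlt, lt_bernoulliCantor_iff hP _ _ hb, Set.mem_ofPred_eq]
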